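/- Call a tree a caterpillar if removing all its leaves (vertices of degree $1$) leaves a path, called its spine; for an integer $\Delta\ge 2$, a caterpillar is $\Delta$-regular if its spine is non-empty and every spine vertex has degree $\Delta$. A packing of $n$-vertex graphs $G_1,\dots,G_h$ is an $n$-vertex graph that contains (copies of) $G_1,\dots,G_h$ as pairwise edge-disjoint spanning subgraphs. A graph is $k$-planar if it has a drawing in the plane (vertices are distinct points, every edge is a simple arc joining its end-vertices and passing through no other vertex) in which each edge is crossed at most $k$ times. Theorem. There is an absolute constant $K$ such that the following holds for all integers $n\ge 1$ and $h\ge 1$. Let $C_1,\dots,C_h$ be $n$-vertex caterpillars such that $C_i$ is $\Delta_i$-regular and $\Delta_i\le n-h$ for $1\le i\le h$, and $\Delta_i-1$ is a multiple of $\Delta_{i+1}-1$ for $1\le i<h$. If $n\ge 2h+(\Delta_1-1)$, then there is a packing of $C_1,\dots,C_h$ that is $k$-planar for some $k\le K(\Delta_1h+h^2)$; that is, $C_1,\dots,C_h$ admit a $k$-planar packing with $k\in O(\Delta_1h+h^2)$. -/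

import Mathlib

namespace CaterpillarPacking

/-- The degree of `v` in `G`. -/
noncomputable def deg {V : Type*} [Fintype V] (G : SimpleGraph V) (v : V) : ℕ :=
  open scoped Classical in G.degree v

/-- The set of vertices that remain after removing all leaves (vertices of degree one). -/
def spine {V : Type*} [Fintype V] (G : SimpleGraph V) : Set V :=
  {v | deg G v ≠ 1}

/-- A caterpillar is a tree such that removing all leaves leaves a path. -/
def IsCaterpillar {V : Type*} [Fintype V] (G : SimpleGraph V) : Prop :=
  G.IsTree ∧ ∃ σ : ℕ, Nonempty (G.induce (spine G) ≃g SimpleGraph.pathGraph σ)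

/-- A `Δ`-regular caterpillar, `Δ ≥ 2`: a caterpillar with at least one spine vertex, all of whose
spine vertices have degree `Δ`. -/
structure IsRegularCaterpillar {V : Type*} [Fintype V] (G : SimpleGraph V) (Δ : ℕ) : Prop where
  two_le : 2 ≤ Δ
  isCaterpillar : IsCaterpillar G
  spine_nonempty : (spine G).Nonempty
  degree_eq : ∀ v ∈ spine G, deg G v = Δ

/-- `G` is a packing of the graphs `H i`: each `H i` can be placed on all of the vertices of `G`
by a bijection `f i`, so that the copies are spanning subgraphs of `G` and are pairwise
edge-disjoint. -/
def IsPacking {ι W : Type*} {V : ι → Type*} (H : ∀ i, SimpleGraph (V i)) (G : SimpleGraph W) :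
    Prop :=
  ∃ f : ∀ i, V i ≃ W,
    (∀ i, (H i).map (f i).toEmbedding ≤ G) ∧
    Pairwise fun i j =>
      Disjoint ((H i).map (f i).toEmbedding).edgeSet ((H j).map (f j).toEmbedding).edgeSet

/-- A drawing of a graph in the plane: distinct vertices are distinct points, every edge is a
simple arc that joins the points of its two end-vertices and contains no other vertex. -/
structure Drawing {V : Type*} (G : SimpleGraph V) where
  /-- the point that represents a vertex -/
  point : V → ℝ × ℝ
  point_injective : Function.Injective point
  /-- the arc that represents an edge -/
  arc : G.edgeSet → unitInterval → ℝ × ℝ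
  arc_continuous : ∀ e, Continuous (arc e)
  arc_injective : ∀ e, Function.Injective (arc e)
  arc_ends : ∀ e : G.edgeSet, s(arc e 0, arc e 1) = (e : Sym2 V).map point
  arc_avoids : ∀ e, ∀ t ∈ Set.Ioo (0 : unitInterval) 1, ∀ v, arc e t ≠ point v

/-- The relative interior of the arc of the edge `e`. -/
def Drawing.interior {V : Type*} {G : SimpleGraph V} (D : Drawing G) (e : G.edgeSet) :
    Set (ℝ × ℝ) :=
  D.arc e '' Set.Ioo (0 : unitInterval) 1

/-- The crossings along the edge `e`: the pairs of another edge `f` and a common interior point of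
`e` and `f`. A point shared by several other edges is counted once for each of them. -/
def Drawing.crossings {V : Type*} {G : SimpleGraph V} (D : Drawing G) (e : G.edgeSet) :
    Set (G.edgeSet × (ℝ × ℝ)) :=
  {x | x.1 ≠ e ∧ x.2 ∈ D.interior e ∧ x.2 ∈ D.interior x.1}

/-- A graph is `k`-planar if it has a drawing in the plane in which every edge is crossed at most
`k` times. -/
def IsKPlanar {V : Type*} (G : SimpleGraph V) (k : ℕ) : Prop :=
  ∃ D : Drawing G, ∀ e : G.edgeSet, (D.crossings e).encard ≤ k

end CaterpillarPacking

namespace CaterpillarPacking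

open SimpleGraph

/-! Place the `n` vertices on a circle. With `d = Δ - 1`, a `Δ`-regular caterpillar is a zigzag: its
`t`-th edge joins position `x = zig d t` to `-1 - (t - x)`. The `k`-th spine vertex owns the indices
from `k * d` to `(k + 1) * d`, sharing the extreme ones with its spine neighbours. The positions
used are `n` consecutive integers, so reduction mod `n` is a bijection (`exists_pos`,
`exists_zigEdge_equiv`). The `i`-th caterpillar is rotated by `i`.

The ends of an edge sum to `2 * i - 1 - (t - 2 * x)` with `0 ≤ t - 2 * x ≤ d`, so all edges are
nearly parallel chords. As `2 * h + d ≤ n`, a common edge of two caterpillars would have equal sums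
over the integers and hence equal indices; divisibility of the steps together with the rotation
excludes this (`zigEdge_ne`).

With the vertices on a parabola, edges cross only if their ends alternate. Near-parallelism leaves
`O(Δ₁ + h)` candidates in each of the `h` caterpillars (`index_of_alternate`). -/

/-! ### Staircase arithmetic -/

/-- The `x`-coordinate after `t` unit steps of the staircase in the grid that starts at the origin
and alternates between `d` steps upwards and `d` steps to the right. -/
def zig (d t : ℕ) : ℕ := t / (2 * d) * d + (t % (2 * d) - d)

lemma zig_add {d r : ℕ} (m : ℕ) (hr : r < 2 * d) : zig d (2 * d * m + r) = m * d + (r - d) := by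
  have hd : 0 < 2 * d := by omega
  simp [zig, Nat.mul_add_div hd, Nat.div_eq_of_lt hr, Nat.mod_eq_of_lt hr]

lemma exists_eq_two_mul_add {d : ℕ} (hd : 0 < d) (t : ℕ) :
    ∃ m r, r < 2 * d ∧ t = 2 * d * m + r :=
  ⟨t / (2 * d), t % (2 * d), Nat.mod_lt _ (by omega), (Nat.div_add_mod _ _).symm⟩

lemma zig_eq_of_even {d m t : ℕ} (hd : 0 < d) (h₁ : 2 * m * d ≤ t) (h₂ : t ≤ (2 * m + 1) * d) :
    zig d t = m * d := by
  obtain ⟨r, rfl⟩ := Nat.exists_eq_add_of_le h₁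
  have : r ≤ d := by nlinarith
  rw [show 2 * m * d = 2 * d * m by ring, zig_add m (by omega)]
  omega

lemma zig_eq_of_odd {d m t : ℕ} (hd : 0 < d) (h₁ : (2 * m + 1) * d ≤ t)
    (h₂ : t ≤ (2 * m + 2) * d) : zig d t + (m + 1) * d = t := by
  obtain ⟨r, rfl⟩ := Nat.exists_eq_add_of_le h₁
  have hr : r ≤ d := by nlinarith
  rcases hr.lt_or_eq with hr | rfl
  · rw [show (2 * m + 1) * d + r = 2 * d * m + (d + r) by ring, zig_add m (by omega)]
    simp only [Nat.add_sub_cancel_left]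
    ring
  · rw [show (2 * m + 1) * r + r = 2 * r * (m + 1) + 0 by ring, zig_add _ (by omega)]
    simp
    ring

lemma two_mul_zig_le {d : ℕ} (hd : 0 < d) (t : ℕ) : 2 * zig d t ≤ t := by
  obtain ⟨m, r, hr, rfl⟩ := exists_eq_two_mul_add hd t
  rw [zig_add m hr, show 2 * d * m = 2 * (m * d) by ring]
  omega

lemma le_two_mul_zig_add {d : ℕ} (hd : 0 < d) (t : ℕ) : t ≤ 2 * zig d t + d := by
  obtain ⟨m, r, hr, rfl⟩ := exists_eq_two_mul_add hd t
  rw [zig_add m hr, show 2 * d * m = 2 * (m * d) by ring]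
  omega

lemma zig_zero (d : ℕ) : zig d 0 = 0 := by simp [zig]

lemma zig_succ {d : ℕ} (hd : 0 < d) (t : ℕ) :
    zig d (t + 1) = zig d t ∨ zig d (t + 1) = zig d t + 1 := by
  obtain ⟨m, r, hr, rfl⟩ := exists_eq_two_mul_add hd t
  rw [zig_add m hr]
  rcases Nat.lt_or_ge (r + 1) (2 * d) with h | h
  · rw [add_assoc, zig_add m h]
    omega
  · rw [show 2 * d * m + r + 1 = 2 * d * (m + 1) + 0 by rw [mul_add]; omega,
      zig_add _ (by omega), add_mul]
    omega

lemma zig_mono {d : ℕ} (hd : 0 < d) : Monotone (zig d) :=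
  monotone_nat_of_le_succ fun t => by rcases zig_succ hd t with h | h <;> omega

lemma zig_add_le {d : ℕ} (hd : 0 < d) (t s : ℕ) : zig d (t + s) ≤ zig d t + s := by
  induction s with
  | zero => simp
  | succ s ih => rcases zig_succ hd (t + s) with h | h <;> rw [← add_assoc] <;> omega

/-- Both staircases pass through the diagonal points reached after multiples of `2 * d` steps.
Between two such points the coarse one makes all its upward steps first, which minimises the
abscissa among monotone lattice paths. -/
lemma zig_le_of_dvd {d d' : ℕ} (hd : 0 < d) (h : d' ∣ d) (t : ℕ) : zig d t ≤ zig d' t := by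
  have hd' := Nat.pos_of_dvd_of_pos h hd
  obtain ⟨m, r, hr, rfl⟩ := exists_eq_two_mul_add hd t
  obtain ⟨c, rfl⟩ := h
  have key : ∀ k, zig d' (2 * (d' * c) * k) = k * (d' * c) := fun k => by
    rw [show 2 * (d' * c) * k = 2 * d' * (c * k) + 0 by ring, zig_add _ (by omega)]
    simp
    ring
  rw [zig_add m hr]
  have h₁ := zig_mono hd' (Nat.le_add_right (2 * (d' * c) * m) r)
  have h₂ := zig_add_le hd' (2 * (d' * c) * m + r) (2 * (d' * c) - r)
  rw [show 2 * (d' * c) * m + r + (2 * (d' * c) - r) = 2 * (d' * c) * (m + 1) by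
    rw [mul_add]; omega, key, add_mul] at h₂
  rw [key] at h₁
  omega

/-! ### Straight-line drawings on a parabola -/

/-- Three positions on a line such that the chords `{a, b}` and `{a', b'}` of a parabola meet. -/
lemma alternate_of_chords_meet {a b a' b' x : ℝ} (ha : a < x) (hb : x < b) (ha' : a' < x)
    (hb' : x < b') (hne : ¬ (a = a' ∧ b = b'))
    (h : (a + b) * x - a * b = (a' + b') * x - a' * b') :
    (a < a' ∧ b < b') ∨ (a' < a ∧ b' < b) := by
  -- Both sides are heights of the chords above the parabola at `x`; for nested chords the outer one
  -- is strictly higher.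
  have h' : (x - a) * (b - x) = (x - a') * (b' - x) := by linarith
  rcases lt_trichotomy a a' with h₁ | h₁ | h₁
  · left
    refine ⟨h₁, ?_⟩
    by_contra! h₂
    nlinarith [mul_pos (sub_pos.2 h₁) (sub_pos.2 hb), mul_nonneg (sub_pos.2 ha').le (sub_nonneg.2 h₂)]
  · subst h₁
    exact absurd ⟨rfl, by have := mul_left_cancel₀ (sub_pos.2 ha).ne' h'; linarith⟩ hne
  · right
    refine ⟨h₁, ?_⟩
    by_contra! h₂
    nlinarith [mul_pos (sub_pos.2 h₁) (sub_pos.2 hb'), mul_nonneg (sub_pos.2 ha).le (sub_nonneg.2 h₂)]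

lemma sym2_eq_inf_sup {α : Type*} [LinearOrder α] (e : Sym2 α) : e = s(e.inf, e.sup) := by
  induction e with
  | h a b => rcases le_total a b with h | h <;> simp [h, Sym2.eq_swap]

lemma inf_lt_sup_of_mem_edgeSet {n : ℕ} {G : SimpleGraph (Fin n)} (e : G.edgeSet) :
    (e : Sym2 (Fin n)).inf < (e : Sym2 (Fin n)).sup := by
  obtain ⟨e, he⟩ := e
  induction e with
  | h a b => exact inf_lt_sup.2 (G.ne_of_adj he)

/-- The point with parameter `t` on the chord of the parabola between the abscissae `a` and `b`. -/
noncomputable def chord (a b : ℝ) (t : unitInterval) : ℝ × ℝ :=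
  (a + t * (b - a), (a + b) * (a + t * (b - a)) - a * b)

/-- The straight-line drawing with the vertices on a parabola. -/
noncomputable def parabolaDrawing {n : ℕ} (G : SimpleGraph (Fin n)) : Drawing G where
  point v := ((v : ℕ), ((v : ℕ) : ℝ) ^ 2)
  point_injective u v h := by
    have := congrArg Prod.fst h
    exact Fin.ext (by simpa using this)
  arc e := chord ((e : Sym2 (Fin n)).inf : ℕ) ((e : Sym2 (Fin n)).sup : ℕ)
  arc_continuous e := by unfold chord; fun_prop
  arc_injective e s t h := by
    have hlt : (((e : Sym2 (Fin n)).inf : ℕ) : ℝ) < ((e : Sym2 (Fin n)).sup : ℕ) :=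
      Nat.cast_lt.2 (inf_lt_sup_of_mem_edgeSet e)
    have := congrArg Prod.fst h
    simp only [chord, add_right_inj] at this
    exact Subtype.ext (mul_right_cancel₀ (sub_pos.2 hlt).ne' this)
  arc_ends e := by
    conv_rhs => rw [sym2_eq_inf_sup (e : Sym2 (Fin n))]
    simp only [chord, Sym2.map_mk, Set.Icc.coe_zero, Set.Icc.coe_one]
    congr 2 <;> simp <;> ring
  arc_avoids e t ht v h := by
    have hlt : (((e : Sym2 (Fin n)).inf : ℕ) : ℝ) < ((e : Sym2 (Fin n)).sup : ℕ) :=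
      Nat.cast_lt.2 (inf_lt_sup_of_mem_edgeSet e)
    have h0 : (0 : ℝ) < t := ht.1
    have h1 : (t : ℝ) < 1 := ht.2
    have hx := congrArg Prod.fst h
    have hy := congrArg Prod.snd h
    simp only [chord] at hx hy
    rw [hx] at hy
    nlinarith [mul_pos (mul_pos h0 (sub_pos.2 h1)) (mul_pos (sub_pos.2 hlt) (sub_pos.2 hlt))]

lemma mem_interior_parabolaDrawing {n : ℕ} {G : SimpleGraph (Fin n)} {e : G.edgeSet} {p : ℝ × ℝ}
    (hp : p ∈ (parabolaDrawing G).interior e) :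
    (((e : Sym2 (Fin n)).inf : ℕ) : ℝ) < p.1 ∧ p.1 < ((e : Sym2 (Fin n)).sup : ℕ) ∧
      p.2 = ((((e : Sym2 (Fin n)).inf : ℕ) : ℝ) + ((e : Sym2 (Fin n)).sup : ℕ)) * p.1 -
        (((e : Sym2 (Fin n)).inf : ℕ) : ℝ) * ((e : Sym2 (Fin n)).sup : ℕ) := by
  obtain ⟨t, ⟨h0, h1⟩, rfl⟩ := hp
  have hlt : (((e : Sym2 (Fin n)).inf : ℕ) : ℝ) < ((e : Sym2 (Fin n)).sup : ℕ) :=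
    Nat.cast_lt.2 (inf_lt_sup_of_mem_edgeSet e)
  have h0 : (0 : ℝ) < t := h0
  have h1 : (t : ℝ) < 1 := h1
  simp only [parabolaDrawing, chord]
  refine ⟨?_, ?_, trivial⟩ <;> nlinarith

/-- The end-vertices of `e` and `f` alternate in the order of the vertices. -/
def Alternate {α : Type*} [LinearOrder α] (e f : Sym2 α) : Prop :=
  (e.inf < f.inf ∧ f.inf < e.sup ∧ e.sup < f.sup) ∨
    (f.inf < e.inf ∧ e.inf < f.sup ∧ f.sup < e.sup)

/-- Crossing chords alternate, and two distinct chords meet at most once, so forgetting the crossing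
point is injective. -/
lemma encard_crossings_parabolaDrawing_le {n : ℕ} (G : SimpleGraph (Fin n)) (e : G.edgeSet) :
    ((parabolaDrawing G).crossings e).encard ≤
      {f | f ∈ G.edgeSet ∧ Alternate (e : Sym2 (Fin n)) f}.encard := by
  refine Set.encard_le_encard_of_injOn (f := fun x => (x.1 : Sym2 (Fin n))) ?_ ?_
  · rintro ⟨f, p⟩ ⟨hne, he, hf⟩
    refine ⟨f.2, ?_⟩
    obtain ⟨h₁, h₂, h₃⟩ := mem_interior_parabolaDrawing he
    obtain ⟨h₄, h₅, h₆⟩ := mem_interior_parabolaDrawing hf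
    have key := alternate_of_chords_meet h₁ h₂ h₄ h₅ (fun h => hne (Subtype.ext ?_))
      (h₃.symm.trans h₆)
    · have h₇ := h₄.trans h₂
      have h₈ := h₁.trans h₅
      simp only [Nat.cast_lt, Fin.val_fin_lt] at key h₇ h₈
      rcases key with ⟨h, h'⟩ | ⟨h, h'⟩
      exacts [Or.inl ⟨h, h₇, h'⟩, Or.inr ⟨h, h₈, h'⟩]
    · simp only [Nat.cast_inj, Fin.val_inj] at h
      dsimp only
      rw [sym2_eq_inf_sup (f : Sym2 (Fin n)), sym2_eq_inf_sup (e : Sym2 (Fin n)), h.1, h.2]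
  · rintro ⟨f, p⟩ ⟨hne, he, hf⟩ ⟨f', q⟩ ⟨-, he', hf'⟩ (hff : (f : Sym2 (Fin n)) = f')
    obtain rfl := Subtype.ext hff
    obtain ⟨h₁, h₂, h₃⟩ := mem_interior_parabolaDrawing he
    obtain ⟨h₄, h₅, h₆⟩ := mem_interior_parabolaDrawing hf
    obtain ⟨-, -, k₃⟩ := mem_interior_parabolaDrawing he'
    obtain ⟨-, -, k₆⟩ := mem_interior_parabolaDrawing hf'
    have hpq : p.1 = q.1 := by
      have key := alternate_of_chords_meet h₁ h₂ h₄ h₅ (fun h => hne (Subtype.ext ?_))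
        (h₃.symm.trans h₆)
      · rw [h₃] at h₆
        rw [k₃] at k₆
        -- Alternation makes the slopes (sums of the end abscissae) differ, so the two lines agree
        -- at only one abscissa.
        refine mul_left_cancel₀ (a := ((((f : Sym2 (Fin n)).inf : ℕ) : ℝ) +
          ((f : Sym2 (Fin n)).sup : ℕ)) - ((((e : Sym2 (Fin n)).inf : ℕ) : ℝ) +
          ((e : Sym2 (Fin n)).sup : ℕ))) ?_ (by linarith)
        rcases key with ⟨h, h'⟩ | ⟨h, h'⟩
        · exact (by linarith : (0 : ℝ) < _).ne'
        · exact (by linarith : _ < (0 : ℝ)).ne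
      · simp only [Nat.cast_inj, Fin.val_inj] at h
        dsimp only
        rw [sym2_eq_inf_sup (f : Sym2 (Fin n)), sym2_eq_inf_sup (e : Sym2 (Fin n)), h.1, h.2]
    have : p.2 = q.2 := by rw [h₃, k₃, hpq]
    rw [Prod.ext hpq this]

/-! ### Zigzag edges: disjointness and alternation -/

/-- The `t`-th edge of the zigzag caterpillar with step `d` on `n` cyclically ordered vertices,
rotated by `i`. -/
def zigEdge {n : ℕ} (hn : 0 < n) (d i t : ℕ) : Sym2 (Fin n) :=
  s(⟨(zig d t + i) % n, Nat.mod_lt _ hn⟩, ⟨(n - 1 - (t - zig d t) + i) % n, Nat.mod_lt _ hn⟩)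

/-- The first end never wraps around, as `zig d t` and `i` are both at most `(n - 2) / 2`. The
second wraps exactly when `t - zig d t < i`; this is the second alternative, and it forces `t < 2 *
i`. -/
lemma zigEdge_inf_sup {n d i t : ℕ} (hn : 0 < n) (hd : 0 < d) (hi : 2 * i + 2 ≤ n)
    (ht : t + 2 ≤ n) :
    (((zigEdge hn d i t).inf : ℕ) = zig d t + i ∧
      ((zigEdge hn d i t).sup : ℕ) + 1 + t = zig d t + i + n) ∨
    (((zigEdge hn d i t).inf : ℕ) + 1 + t = zig d t + i ∧
      ((zigEdge hn d i t).sup : ℕ) = zig d t + i) := by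
  have h₁ := two_mul_zig_le hd t
  simp only [zigEdge, Sym2.inf_mk, Sym2.sup_mk, Fin.val_strictMono.monotone.map_min,
    Fin.val_strictMono.monotone.map_max]
  rw [Nat.mod_eq_of_lt (a := zig d t + i) (by omega)]
  rcases Nat.lt_or_ge (n - 1 - (t - zig d t) + i) n with h | h
  · rw [Nat.mod_eq_of_lt h]
    omega
  · rw [Nat.mod_eq_sub_mod h, Nat.mod_eq_of_lt (by omega)]
    omega

/-- For `t = t'`, `zig_le_of_dvd` and `i < j` put the second edge strictly ahead. For `t ≠ t'`,
equal chords need `t + t' + 2 = n` with one of them wrapped, and then `2 * h + d ≤ n` is violated.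
-/
lemma zigEdge_ne {n h d d' i j t t' : ℕ} (hn : 0 < n) (hd : 0 < d) (hdvd : d' ∣ d)
    (hij : i < j) (hj : j < h) (hnd : 2 * h + d ≤ n) (ht : t + 2 ≤ n) (ht' : t' + 2 ≤ n) :
    zigEdge hn d i t ≠ zigEdge hn d' j t' := by
  intro heq
  have hd' := Nat.pos_of_dvd_of_pos hdvd hd
  have hle := Nat.le_of_dvd hd hdvd
  have h₁ := two_mul_zig_le hd t
  have h₂ := le_two_mul_zig_add hd t
  have h₃ := two_mul_zig_le hd' t'
  have h₄ := le_two_mul_zig_add hd' t'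
  have h₅ := zigEdge_inf_sup (d := d) (i := i) (t := t) hn hd (by omega) ht
  have h₆ := zigEdge_inf_sup (d := d') (i := j) (t := t') hn hd' (by omega) ht'
  have h₇ := zig_le_of_dvd hd hdvd t
  rw [heq] at h₅
  by_cases htt : t = t'
  · subst htt
    omega
  · omega

/-- The edges of the zigzag caterpillar with step `d'`, rotated by `j`, that alternate with a given
zigzag edge have indices in an initial segment or in an interval, both short. -/
lemma index_of_alternate {n h D d d' i j t : ℕ} (hn : 0 < n) (hd : 0 < d) (hd' : 0 < d')
    (hdD : d ≤ D) (hdD' : d' ≤ D) (hi : i < h) (hj : j < h) (hnd : 2 * h + D ≤ n)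
    (ht : t + 2 ≤ n) :
    ∃ A, ∀ t', t' + 2 ≤ n → Alternate (zigEdge hn d i t) (zigEdge hn d' j t') →
      t' < 2 * h ∨ A ≤ t' ∧ t' < A + (8 * h + 5 * D + 1) := by
  have h₁ := two_mul_zig_le hd t
  have h₂ := le_two_mul_zig_add hd t
  have h₅ := zigEdge_inf_sup (d := d) (i := i) (t := t) hn hd (by omega) ht
  rcases h₅ with h₅ | h₅
  -- A wrapped edge has `t' < 2 * h`. Otherwise the end sums differ by at most `D + 2 * h`, and
  -- alternation moves both ends the same way, so `zig d' t' + j` is within `D + 2 * h` of `zig d t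
  -- + i`. Since `2 * zig d' t' ≤ t' ≤ 2 * zig d' t' + D`, this leaves a range of length `8 * h + 5
  -- * D` for `t'`.
  · refine ⟨2 * (zig d t + i) - 2 * (D + 2 * h) - 2 * j, fun t' ht' halt => ?_⟩
    have h₃ := two_mul_zig_le hd' t'
    have h₄ := le_two_mul_zig_add hd' t'
    have h₆ := zigEdge_inf_sup (d := d') (i := j) (t := t') hn hd' (by omega) ht'
    simp only [Alternate, Fin.lt_def] at halt
    omega
  -- A wrapped edge has both ends below `2 * h`, so an alternating unwrapped edge starts there and
  -- has small index.
  · refine ⟨0, fun t' ht' halt => ?_⟩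
    have h₃ := two_mul_zig_le hd' t'
    have h₄ := le_two_mul_zig_add hd' t'
    have h₆ := zigEdge_inf_sup (d := d') (i := j) (t := t') hn hd' (by omega) ht'
    simp only [Alternate, Fin.lt_def] at halt
    omega

lemma encard_alternate_le {n h D : ℕ} (hn : 0 < n) {d : Fin h → ℕ} (hd : ∀ i, 0 < d i)
    (hdD : ∀ i, d i ≤ D) (hnd : 2 * h + D ≤ n) {S : Set (Sym2 (Fin n))}
    (hS : ∀ e ∈ S, ∃ i, ∃ t, t + 2 ≤ n ∧ e = zigEdge hn (d i) i t) {e : Sym2 (Fin n)}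
    (he : e ∈ S) :
    {f | f ∈ S ∧ Alternate e f}.encard ≤ (h * (2 * h + (8 * h + 5 * D + 1)) : ℕ) := by
  obtain ⟨i, t, ht, rfl⟩ := hS e he
  choose A hA using fun j : Fin h =>
    index_of_alternate (j := j) hn (hd i) (hd j) (hdD i) (hdD j) i.2 j.2 hnd ht
  let T : Finset (Sym2 (Fin n)) := Finset.univ.biUnion fun j : Fin h =>
    (Finset.range (2 * h) ∪ Finset.Ico (A j) (A j + (8 * h + 5 * D + 1))).image (zigEdge hn (d j) j)
  have hsub : {f | f ∈ S ∧ Alternate (zigEdge hn (d i) i t) f} ⊆ (T : Set (Sym2 (Fin n))) := by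
    rintro f ⟨hf, halt⟩
    obtain ⟨j, t', ht', rfl⟩ := hS f hf
    refine Finset.mem_coe.2 (Finset.mem_biUnion.2 ⟨j, Finset.mem_univ j,
      Finset.mem_image_of_mem _ ?_⟩)
    simpa using hA j t' ht' halt
  refine (Set.encard_le_encard hsub).trans ?_
  rw [Set.encard_coe_eq_coe_finsetCard, Nat.cast_le]
  refine (Finset.card_biUnion_le_card_mul _ _ (2 * h + (8 * h + 5 * D + 1)) fun j _ => ?_).trans
    (by simp)
  refine Finset.card_image_le.trans ((Finset.card_union_le _ _).trans ?_)
  simp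

/-! ### Structure of regular caterpillars -/

lemma deg_eq_ncard {V : Type*} [Fintype V] (G : SimpleGraph V) (v : V) :
    deg G v = (G.neighborSet v).ncard := by
  classical
  rw [deg, Set.ncard_eq_toFinset_card', ← SimpleGraph.card_neighborFinset_eq_degree]
  congr!

/-- In a connected graph with a vertex of degree other than one, each vertex of degree one is
adjacent to a vertex of a different degree. -/
lemma exists_spine_adj {V : Type*} [Fintype V] {G : SimpleGraph V} (hG : G.Connected)
    (hs : (spine G).Nonempty) {w : V} (hw : w ∉ spine G) :
    ∃ v ∈ spine G, G.neighborSet w = {v} := by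
  have leaf : ∀ u, u ∉ spine G → ∃ v, G.neighborSet u = {v} := fun u hu => by
    rw [← Set.ncard_eq_one, ← deg_eq_ncard]
    exact not_not.1 hu
  obtain ⟨v, hv⟩ := leaf w hw
  refine ⟨v, by_contra fun hvs => ?_, hv⟩
  obtain ⟨w', hw'⟩ := leaf v hvs
  have hwv : G.Adj w v := by
    have : v ∈ G.neighborSet w := hv ▸ rfl
    exact this
  have : w = w' := by
    have : w ∈ G.neighborSet v := hwv.symm
    rwa [hw'] at this
  subst this
  -- Two adjacent leaves would form a whole component, missing the spine.
  have closed : ∀ a b : V, G.Walk a b → a = w ∨ a = v → b = w ∨ b = v := by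
    intro a b p
    induction p with
    | nil => exact id
    | cons hab _ ih =>
      rintro (rfl | rfl)
      · refine ih (Or.inr ?_)
        have := (G.mem_neighborSet _ _).2 hab
        rwa [hv] at this
      · refine ih (Or.inl ?_)
        have := (G.mem_neighborSet _ _).2 hab
        rwa [hw'] at this
  obtain ⟨s, hs⟩ := hs
  obtain ⟨p⟩ := hG.preconnected w s
  rcases closed _ _ p (Or.inl rfl) with rfl | rfl
  exacts [hw hs, hvs hs]

/-- Handshake count: a tree's degrees sum to twice its order minus two. -/
lemma card_eq_of_isRegularCaterpillar {V : Type*} [Fintype V] {G : SimpleGraph V} {Δ : ℕ}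
    (hG : IsRegularCaterpillar G Δ) {σ : ℕ} (hσ : (spine G).ncard = σ) :
    Fintype.card V = σ * (Δ - 1) + 2 := by
  classical
  have h₁ := hG.isCaterpillar.1.card_edgeFinset
  have h₂ := G.sum_degrees_eq_twice_card_edges
  have h₃ : ∀ v, G.degree v = 1 + if v ∈ spine G then Δ - 1 else 0 := fun v => by
    have : deg G v = G.degree v := by unfold deg; congr!
    have := hG.two_le
    split_ifs with hv
    · have := hG.degree_eq v hv
      omega
    · have : deg G v = 1 := not_not.1 hv
      omega
  simp only [h₃, Finset.sum_add_distrib, Finset.sum_ite, Finset.sum_const] at h₂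
  have h₄ : (Finset.univ.filter (· ∈ spine G)).card = σ := by
    rw [← hσ, ← Set.ncard_coe_finset]
    simp
  rw [h₄] at h₂
  simp at h₂
  omega

/-! ### Laying out a caterpillar as a zigzag -/

/-- The position of the `k`-th spine vertex of the zigzag caterpillar with step `d`. -/
def spinePos (d k : ℕ) : ℤ := if Even k then (k / 2 * d : ℕ) else -1 - ((k + 1) / 2 * d : ℕ)

/-- The position of the other end-vertex of the `t`-th edge at the `k`-th spine vertex of the
zigzag caterpillar with step `d`. -/
def nbrPos (d k t : ℕ) : ℤ :=
  if Even k then -1 - ((t : ℤ) - (k / 2 * d : ℕ)) else (t : ℤ) - ((k + 1) / 2 * d : ℕ)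

lemma nbrPos_succ (d k : ℕ) : nbrPos d k ((k + 1) * d) = spinePos d (k + 1) := by
  rcases Nat.even_or_odd' k with ⟨m, rfl | rfl⟩
  · have h₁ : (2 * m + 1 + 1) / 2 = m + 1 := by omega
    simp [nbrPos, spinePos, h₁]
    ring
  · have h₁ : (2 * m + 1 + 1) / 2 = m + 1 := by omega
    simp [nbrPos, spinePos, h₁, Nat.even_add_one]
    ring

lemma nbrPos_pred (d k : ℕ) : nbrPos d (k + 1) ((k + 1) * d) = spinePos d k := by
  rcases Nat.even_or_odd' k with ⟨m, rfl | rfl⟩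
  · have h₁ : (2 * m + 1 + 1) / 2 = m + 1 := by omega
    simp [nbrPos, spinePos, h₁]
    ring
  · have h₁ : (2 * m + 1 + 1) / 2 = m + 1 := by omega
    simp [nbrPos, spinePos, h₁, Nat.even_add_one]
    ring

lemma pos_eq {d k t : ℕ} (hd : 0 < d) (h₁ : k * d ≤ t) (h₂ : t ≤ (k + 1) * d) :
    (spinePos d k = zig d t ∧ nbrPos d k t = -1 - ((t : ℤ) - zig d t)) ∨
    (nbrPos d k t = zig d t ∧ spinePos d k = -1 - ((t : ℤ) - zig d t)) := by
  rcases Nat.even_or_odd' k with ⟨m, rfl | rfl⟩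
  · left
    have := zig_eq_of_even hd h₁ h₂
    simp [nbrPos, spinePos, this]
  · right
    have h₃ := zig_eq_of_odd hd h₁ h₂
    have h₁ : (2 * m + 1 + 1) / 2 = m + 1 := by omega
    zify at h₃
    simp [nbrPos, spinePos, h₁]
    constructor <;> linarith

/-- A function whose values contain the ends of all zigzag edges up to the `t`-th one takes all
values between the ends of that edge. -/
lemma exists_pos_eq {V : Type*} {N d : ℕ} (hd : 0 < d) {pos : V → ℤ}
    (h : ∀ t ≤ N, (∃ v, pos v = zig d t) ∧ ∃ v, pos v = -1 - ((t : ℤ) - zig d t))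
    (t : ℕ) (ht : t ≤ N) :
    ∀ z : ℤ, -1 - ((t : ℤ) - zig d t) ≤ z → z ≤ zig d t → ∃ v, pos v = z := by
  induction t with
  | zero =>
    intro z h₁ h₂
    rw [zig_zero] at h₁ h₂
    have := h 0 ht
    rw [zig_zero] at this
    obtain rfl | rfl : z = 0 ∨ z = -1 := by push_cast at h₁ h₂; omega
    exacts [by simpa using this.1, by simpa using this.2]
  | succ t ih =>
    intro z h₁ h₂
    have ih := ih (by omega) z
    obtain ⟨k₁, k₂⟩ := h (t + 1) ht
    push_cast at h₁ h₂ k₁ k₂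
    rcases eq_or_ne z (zig d (t + 1)) with rfl | h₃
    · exact k₁
    rcases eq_or_ne z (-1 - ((t : ℤ) + 1 - zig d (t + 1))) with rfl | h₄
    · exact k₂
    -- Each step lengthens the interval by one at one end, and that new end is already excluded.
    rcases zig_succ hd t with h₅ | h₅ <;> rw [h₅] at h₁ h₂ h₃ h₄ <;> push_cast at h₁ h₂ h₃ h₄ <;>
      exact ih (by omega) (by omega)

/-- The edges at an inner vertex of a path of the spine can be numbered by an interval in such a
way that the previous and the next spine vertex get the extreme numbers. -/
lemma exists_numbering {V : Type*} [Fintype V] {G : SimpleGraph V} {d σ : ℕ} (hd : 0 < d)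
    {p : Fin σ → V} (hp : Function.Injective p)
    (hadj : ∀ k l, G.Adj (p k) (p l) ↔ (k : ℕ) + 1 = l ∨ (l : ℕ) + 1 = k) (k : Fin σ)
    (hdeg : deg G (p k) = d + 1) :
    ∃ e : V → ℕ, (∀ w, G.Adj (p k) w → k * d ≤ e w ∧ e w ≤ (k + 1) * d) ∧
      (∀ t, k * d ≤ t → t ≤ (k + 1) * d → ∃ w, G.Adj (p k) w ∧ e w = t) ∧
      (∀ l : Fin σ, (k : ℕ) + 1 = l → e (p l) = (k + 1) * d) ∧
      ∀ l : Fin σ, (l : ℕ) + 1 = k → e (p l) = k * d := by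
  classical
  have hlt : (k : ℕ) * d < (k + 1) * d := by nlinarith
  let s : Finset (G.neighborSet (p k)) := Finset.univ.filter fun w => ∃ l, p l = w
  -- Only the values on `s` are prescribed; there the second branch means the previous spine vertex.
  -- Leaves get the remaining numbers.
  let f : G.neighborSet (p k) → ℕ := fun w =>
    if ∃ l : Fin σ, (k : ℕ) + 1 = l ∧ p l = w then (k + 1) * d else k * d
  have hcard : Fintype.card (G.neighborSet (p k)) = (Finset.Icc (k * d) ((k + 1) * d)).card := by
    rw [deg_eq_ncard, Set.ncard_eq_toFinset_card', Set.toFinset_card] at hdeg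
    rw [hdeg, Nat.card_Icc, add_mul]
    omega
  obtain ⟨g, hg⟩ := Finset.exists_equiv_extend_of_card_eq hcard (s := s) (f := f) (by
    intro t ht
    obtain ⟨w, -, rfl⟩ := Finset.mem_image.1 ht
    simp only [f, Finset.mem_Icc]
    split_ifs <;> omega) (by
    rintro ⟨a, ha⟩ ha' ⟨b, hb⟩ hb' hab
    obtain ⟨l, rfl : p l = a⟩ := (Finset.mem_filter.1 ha').2
    obtain ⟨m, rfl : p m = b⟩ := (Finset.mem_filter.1 hb').2
    have hl := (hadj _ _).1 ha
    have hm := (hadj _ _).1 hb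
    simp only [f, hp.eq_iff, exists_eq_right] at hab
    refine Subtype.ext (congrArg p (Fin.ext ?_))
    split_ifs at hab <;> omega)
  refine ⟨fun w => if hw : G.Adj (p k) w then g ⟨w, hw⟩ else 0, fun w hw => ?_, fun t h₁ h₂ => ?_,
    fun l hl => ?_, fun l hl => ?_⟩
  · simp only [hw, dif_pos]
    exact Finset.mem_Icc.1 (g ⟨w, hw⟩).2
  · obtain ⟨⟨w, hw⟩, hwt⟩ := g.surjective ⟨t, Finset.mem_Icc.2 ⟨h₁, h₂⟩⟩
    refine ⟨w, hw, ?_⟩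
    rw [mem_neighborSet] at hw
    simp [hw, hwt]
  · have h : G.Adj (p k) (p l) := (hadj _ _).2 (Or.inl hl)
    simp only [h, dif_pos]
    rw [hg ⟨p l, h⟩ (Finset.mem_filter.2 ⟨Finset.mem_univ _, l, rfl⟩)]
    exact if_pos ⟨l, hl, rfl⟩
  · have h : G.Adj (p k) (p l) := (hadj _ _).2 (Or.inr hl)
    simp only [h, dif_pos]
    rw [hg ⟨p l, h⟩ (Finset.mem_filter.2 ⟨Finset.mem_univ _, l, rfl⟩)]
    refine if_neg ?_
    rintro ⟨m, hm, hml⟩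
    have := hp hml
    subst this
    omega

/-- A regular caterpillar can be drawn as a zigzag: there are positions for its vertices such that
the pairs of end-vertices of its edges are exactly the zigzag pairs. -/
lemma exists_pos {V : Type*} [Fintype V] {C : SimpleGraph V} {Δ : ℕ}
    (hC : IsRegularCaterpillar C Δ) :
    ∃ (pos : V → ℤ) (N : ℕ), Fintype.card V = N + 2 ∧
      (∀ u v, C.Adj u v → ∃ t ≤ N,
        (pos u = zig (Δ - 1) t ∧ pos v = -1 - ((t : ℤ) - zig (Δ - 1) t)) ∨
        (pos v = zig (Δ - 1) t ∧ pos u = -1 - ((t : ℤ) - zig (Δ - 1) t))) ∧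
      ∀ t ≤ N, (∃ v, pos v = zig (Δ - 1) t) ∧ ∃ v, pos v = -1 - ((t : ℤ) - zig (Δ - 1) t) := by
  classical
  obtain ⟨σ, ⟨φ⟩⟩ := hC.isCaterpillar.2
  have hd : 0 < Δ - 1 := by have := hC.two_le; omega
  have hΔ : Δ = Δ - 1 + 1 := by omega
  have hcard := card_eq_of_isRegularCaterpillar hC (σ := σ) (by
    rw [← Nat.card_coe_set_eq, Nat.card_congr φ.toEquiv, Nat.card_fin])
  have hσ : 0 < σ := by
    obtain ⟨v, hv⟩ := hC.spine_nonempty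
    exact (φ ⟨v, hv⟩).pos
  generalize Δ - 1 = d at *
  let p : Fin σ → V := fun k => φ.symm k
  have hp : Function.Injective p := Subtype.val_injective.comp φ.symm.injective
  have hps : ∀ k, p k ∈ spine C := fun k => (φ.symm k).2
  have hφ : ∀ v (hv : v ∈ spine C), p (φ ⟨v, hv⟩) = v := fun v hv => by simp [p]
  have hadj : ∀ k l, C.Adj (p k) (p l) ↔ (k : ℕ) + 1 = l ∨ (l : ℕ) + 1 = k := fun k l => by
    rw [← pathGraph_adj, ← φ.symm.map_adj_iff]
    rfl
  choose e he₁ he₂ he₃ he₄ using fun k =>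
    exists_numbering hd hp hadj k ((hC.degree_eq _ (hps k)).trans hΔ)
  have hleaf : ∀ w, w ∉ spine C → ∃ k, C.neighborSet w = {p k} := fun w hw => by
    obtain ⟨v, hv, h⟩ :=
      exists_spine_adj hC.isCaterpillar.1.connected hC.spine_nonempty hw
    exact ⟨φ ⟨v, hv⟩, by rw [h, hφ]⟩
  choose nb hnb using hleaf
  let pos : V → ℤ := fun v =>
    if hv : v ∈ spine C then spinePos d (φ ⟨v, hv⟩) else nbrPos d (nb v hv) (e (nb v hv) v)
  have pos_p : ∀ k, pos (p k) = spinePos d k := fun k => by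
    simp only [pos, hps, dif_pos]
    rw [show φ ⟨p k, hps k⟩ = k from hp (hφ _ _)]
  have pos_nbr : ∀ k w, C.Adj (p k) w → pos w = nbrPos d k (e k w) := fun k w hw => by
    by_cases hws : w ∈ spine C
    · obtain ⟨l, rfl⟩ : ∃ l, p l = w := ⟨_, hφ w hws⟩
      rw [pos_p]
      rcases (hadj _ _).1 hw with h | h
      · rw [he₃ k l h, nbrPos_succ, h]
      · rw [he₄ k l h, ← h, nbrPos_pred]
    · have : p k ∈ C.neighborSet w := hw.symm
      rw [hnb w hws] at this
      have : nb w hws = k := (hp this).symm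
      simp only [pos, hws, dif_neg, not_false_eq_true, this]
  have hedge : ∀ k w, C.Adj (p k) w →
      (pos (p k) = zig d (e k w) ∧ pos w = -1 - ((e k w : ℤ) - zig d (e k w))) ∨
      (pos w = zig d (e k w) ∧ pos (p k) = -1 - ((e k w : ℤ) - zig d (e k w))) :=
    fun k w hw => by
      rw [pos_p, pos_nbr k w hw]
      exact pos_eq hd (he₁ k w hw).1 (he₁ k w hw).2
  have hle : ∀ k w, C.Adj (p k) w → e k w ≤ σ * d := fun k w hw =>
    (he₁ k w hw).2.trans (Nat.mul_le_mul_right _ k.2)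
  refine ⟨pos, σ * d, hcard, fun u v huv => ?_, fun t ht => ?_⟩
  · by_cases hu : u ∈ spine C
    · obtain ⟨k, rfl⟩ : ∃ k, p k = u := ⟨_, hφ u hu⟩
      exact ⟨e k v, hle k v huv, hedge k v huv⟩
    · have : v ∈ C.neighborSet u := huv
      rw [hnb u hu] at this
      obtain rfl : v = p (nb u hu) := this
      exact ⟨_, hle _ u huv.symm, (hedge _ u huv.symm).symm⟩
  · obtain ⟨k, hk₁, hk₂⟩ : ∃ k : Fin σ, k * d ≤ t ∧ t ≤ (k + 1) * d := by
      -- The quotient `t / d` overshoots only at the final index `σ * d`, which belongs to the last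
      -- spine vertex.
      rcases ht.lt_or_eq with ht | rfl
      · refine ⟨⟨t / d, (Nat.div_lt_iff_lt_mul hd).2 ht⟩, Nat.div_mul_le_self t d, ?_⟩
        have := Nat.div_add_mod t d
        have := Nat.mod_lt t hd
        dsimp only
        nlinarith
      · refine ⟨⟨σ - 1, by omega⟩, Nat.mul_le_mul_right _ (by simp), ?_⟩
        simp [Nat.sub_add_cancel hσ]
    obtain ⟨w, hw, rfl⟩ := he₂ k t hk₁ hk₂
    rcases hedge k w hw with ⟨h₁, h₂⟩ | ⟨h₁, h₂⟩
    exacts [⟨⟨_, h₁⟩, _, h₂⟩, ⟨⟨_, h₁⟩, _, h₂⟩]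

lemma exists_zigEdge_equiv {n : ℕ} (hn : 0 < n) {C : SimpleGraph (Fin n)} {Δ : ℕ}
    (hC : IsRegularCaterpillar C Δ) (i : ℕ) :
    ∃ f : Fin n ≃ Fin n, ∀ e ∈ (C.map f.toEmbedding).edgeSet,
      ∃ t, t + 2 ≤ n ∧ e = zigEdge hn (Δ - 1) i t := by
  obtain ⟨pos, N, hN, hedge, hend⟩ := exists_pos hC
  have hd : 0 < Δ - 1 := by have := hC.two_le; omega
  rw [Fintype.card_fin] at hN
  generalize Δ - 1 = d at *
  have hn' : (n : ℤ) ≠ 0 := by omega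
  let f : Fin n → Fin n := fun v => ⟨((pos v + i) % n).toNat, by
    have := Int.emod_nonneg (pos v + i) hn'
    have := Int.emod_lt_of_pos (pos v + i) (b := n) (by omega)
    omega⟩
  have hf : ∀ v, ((f v : ℕ) : ℤ) = (pos v + i) % n := fun v =>
    Int.toNat_of_nonneg (Int.emod_nonneg _ hn')
  have hsurj : Function.Surjective f := by
    intro y
    -- The lowest position is `-c`, and the positions from `-c` to `zig d N` number `N + 2 = n`, one
    -- for each residue.
    let c : ℤ := 1 + ((N : ℤ) - zig d N)
    have h₁ := Int.emod_nonneg ((y : ℤ) - i + c) hn'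
    have h₂ := Int.emod_lt_of_pos ((y : ℤ) - i + c) (b := n) (by omega)
    obtain ⟨v, hv⟩ := exists_pos_eq hd hend N le_rfl (((y : ℤ) - i + c) % n - c)
      (by omega) (by omega)
    refine ⟨v, Fin.ext (Int.natCast_inj.1 ?_)⟩
    rw [hf, hv, sub_add, Int.emod_sub_emod, show (y : ℤ) - i + c - (c - i) = y by ring]
    exact Int.emod_eq_of_lt (by omega) (by omega)
  have hbij : Function.Bijective f := Finite.surjective_iff_bijective.1 hsurj
  have hz : ∀ t ≤ N, ∀ u v, pos u = zig d t → pos v = -1 - ((t : ℤ) - zig d t) →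
      s(f u, f v) = zigEdge hn d i t := fun t ht u v hu hv => by
    have := two_mul_zig_le hd t
    have h₁ : f u = ⟨(zig d t + i) % n, Nat.mod_lt _ hn⟩ := by
      refine Fin.ext (Int.natCast_inj.1 ?_)
      rw [hf, hu]
      push_cast
      rfl
    have h₂ : f v = ⟨(n - 1 - (t - zig d t) + i) % n, Nat.mod_lt _ hn⟩ := by
      refine Fin.ext (Int.natCast_inj.1 ?_)
      rw [hf, hv, Int.natCast_mod, ← Int.add_emod_left]
      congr 1
      omega
    rw [h₁, h₂, zigEdge]
  refine ⟨Equiv.ofBijective f hbij, fun e he => ?_⟩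
  induction e with
  | h a b =>
    obtain ⟨u, v, huv, rfl, rfl⟩ := (SimpleGraph.map_adj _ _ _ _).1 he
    obtain ⟨t, ht, ⟨h₁, h₂⟩ | ⟨h₁, h₂⟩⟩ := hedge u v huv
    · exact ⟨t, by omega, hz t ht u v h₁ h₂⟩
    · exact ⟨t, by omega, Sym2.eq_swap.trans (hz t ht v u h₁ h₂)⟩

end CaterpillarPacking

/-! ### The packing theorem -/

theorem theorem4 :
    ∃ K : ℕ, ∀ (n h : ℕ) (hh : 0 < h) (Δ : Fin h → ℕ) (C : Fin h → SimpleGraph (Fin n)),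
      (∀ i, CaterpillarPacking.IsRegularCaterpillar (C i) (Δ i)) →
      (∀ i j : Fin h, (i : ℕ) + 1 = (j : ℕ) → (Δ j - 1) ∣ (Δ i - 1)) →
      (∀ i, Δ i + h ≤ n) →
      2 * h + (Δ ⟨0, hh⟩ - 1) ≤ n →
      ∃ (G : SimpleGraph (Fin n)) (k : ℕ),
        CaterpillarPacking.IsPacking C G ∧
        CaterpillarPacking.IsKPlanar G k ∧
        k ≤ K * (Δ ⟨0, hh⟩ * h + h ^ 2) := by
  open CaterpillarPacking in
  refine ⟨10, fun n h hh Δ C hC hdvd _ hn => ?_⟩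
  have hn₀ : 0 < n := by omega
  have hΔ : ∀ i, 0 < Δ i - 1 := fun i => by have := (hC i).two_le; omega
  have hdvd' : ∀ (m : ℕ) (i j : Fin h), (i : ℕ) + m = j → (Δ j - 1) ∣ (Δ i - 1) := by
    intro m
    induction m with
    | zero =>
      intro i j hij
      obtain rfl : i = j := Fin.ext hij
      exact dvd_rfl
    | succ m ih =>
      intro i j hij
      exact (hdvd ⟨i + m, by omega⟩ j (by dsimp only; omega)).trans (ih i _ rfl)
  have hle : ∀ i j : Fin h, i ≤ j → Δ j - 1 ≤ Δ i - 1 := fun i j hij =>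
    Nat.le_of_dvd (hΔ i) (hdvd' (j - i) i j (by have := Fin.le_def.1 hij; omega))
  choose f hf using fun i : Fin h => exists_zigEdge_equiv hn₀ (hC i) i
  have hdisj : ∀ i j : Fin h, i < j → Disjoint ((C i).map (f i).toEmbedding).edgeSet
      ((C j).map (f j).toEmbedding).edgeSet := fun i j hij => by
    rw [Set.disjoint_left]
    intro e hi hj
    obtain ⟨t, ht, h₁⟩ := hf i e hi
    obtain ⟨t', ht', h₂⟩ := hf j e hj
    have := hle ⟨0, hh⟩ i (Fin.le_def.2 (Nat.zero_le _))
    exact zigEdge_ne hn₀ (hΔ i) (hdvd' (j - i) i j (by have := Fin.lt_def.1 hij; omega)) hij j.2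
      (by omega) ht ht' (h₁.symm.trans h₂)
  refine ⟨⨆ i, (C i).map (f i).toEmbedding, _, ⟨f, fun i => le_iSup_of_le i le_rfl,
    fun i j hij => ?_⟩, ⟨parabolaDrawing _, fun e =>
      (encard_crossings_parabolaDrawing_le _ e).trans
        (encard_alternate_le hn₀ hΔ (fun i => hle ⟨0, hh⟩ i (Fin.le_def.2 (Nat.zero_le _))) hn
          (fun e he => ?_) e.2)⟩, ?_⟩
  · rcases hij.lt_or_gt with hij | hij
    exacts [hdisj i j hij, (hdisj j i hij).symm]
  · rw [SimpleGraph.edgeSet_iSup, Set.mem_iUnion] at he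
    obtain ⟨i, hi⟩ := he
    exact ⟨i, hf i e hi⟩
  -- The crossing bound is `h * (10 * h + 5 * (Δ₁ - 1) + 1)`, so `K = 10` suffices.
  · have := hΔ ⟨0, hh⟩
    obtain ⟨d, hd⟩ : ∃ d, Δ ⟨0, hh⟩ = d + 1 := ⟨_, (Nat.sub_add_cancel (by omega)).symm⟩
    rw [hd, Nat.add_sub_cancel]
    nlinarith
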